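/- For integers $\lambda_1\le\dots\le\lambda_n$, the Gelfand--Zetlin polytope $GZ(\lambda_1,\dots,\lambda_n)\subset\mathbb{R}^{n(n-1)/2}$ is the set of all points with coordinates $u_{i,j}$ ($1\le i\le n-1$, $1\le j\le n-i$) such that, setting $u_{0,j}=\lambda_j$ for $1\le j\le n$, we have $u_{i-1,j}\le u_{i,j}\le u_{i-1,j+1}$ for all $1\le i\le n-1$ and $1\le j\le n-i$ (for $n\le 1$ it is a single point). For integers $k,\ell,m\ge 0$ let $V_{k,\ell,m}$ be the number of vertices of the Gelfand--Zetlin polytope of the sequence consisting of $k$ copies of $1$, then $\ell$ copies of $2$, then $m$ copies of $3$, and let $$G_3(x,y,z)=\sum_{k,\ell,m\ge 0}V_{k,\ell,m}\,x^ky^\ell z^m\in\mathbb{Q}[[x,y,z]]$$ be the ordinary generating function of these numbers. Theorem. Let $\sqrt{1-2(x+z)+(x-z)^2}$ denote the unique formal power series with constant term $1$ whose square is $1-2(x+z)+(x-z)^2$. Then, in the field of fractions of $\mathbb{Q}[[x,y,z]]$, $$G_3(x,y,z)=\frac{2xz-y(1-x-z)-y\sqrt{1-2(x+z)+(x-z)^2}}{2(1-x-z)\bigl((x+y)(y+z)-y\bigr)}.$$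 -/

import Mathlib

/-- The labels `(i, j)` of the coordinates `u_{i,j}` of `ℝ^{n(n-1)/2}`:
`i` runs from `1` to `n - 1` and `j` runs from `1` to `n - i`. -/
abbrev GZIndex (n : ℕ) : Type :=
  {q : ℕ × ℕ // 1 ≤ q.1 ∧ 1 ≤ q.2 ∧ q.1 + q.2 ≤ n}

/-- The Gelfand--Zetlin polytope of a sequence `λ_1, …, λ_n` of integers (`λ_j` is
`lam ⟨j - 1, _⟩`). In the triangular table with top row `λ_1, …, λ_n` and further rows
`u_{i,1}, …, u_{i,n-i}`, every entry lies between its two upper neighbours. -/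
def gzPolytope {n : ℕ} (lam : Fin n → ℤ) : Set (GZIndex n → ℝ) :=
  {u | (∀ (j : ℕ) (hj : 1 ≤ j) (hn : 1 + j ≤ n),
          (lam ⟨j - 1, by omega⟩ : ℝ) ≤ u ⟨(1, j), le_refl 1, hj, hn⟩ ∧
          u ⟨(1, j), le_refl 1, hj, hn⟩ ≤ (lam ⟨j, by omega⟩ : ℝ)) ∧
       (∀ (i j : ℕ) (hi : 1 ≤ i) (hj : 1 ≤ j) (hn : i + 1 + j ≤ n),
          u ⟨(i, j), hi, hj, by dsimp only; omega⟩ ≤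
            u ⟨(i + 1, j), by dsimp only; omega, hj, hn⟩ ∧
          u ⟨(i + 1, j), by dsimp only; omega, hj, hn⟩ ≤
            u ⟨(i, j + 1), hi, by dsimp only; omega, by dsimp only; omega⟩)}

/-- The partition `1^{i_1} 2^{i_2} … k^{i_k}`, as a non-decreasing list of integers
(`i_j` is `i ⟨j - 1, _⟩`). -/
def multPartition {k : ℕ} (i : Fin k → ℕ) : List ℤ :=
  (List.ofFn fun j : Fin k => List.replicate (i j) ((j : ℕ) + 1 : ℤ)).flatten

/-- `V(1^{i_1} … k^{i_k})`: the number of vertices (extreme points) of the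
Gelfand--Zetlin polytope of `1^{i_1} … k^{i_k}`. -/
noncomputable def gzVertexCount {k : ℕ} (i : Fin k → ℕ) : ℕ :=
  (Set.extremePoints ℝ (gzPolytope (multPartition i).get)).ncard

/-- The ordinary generating function `G_k`, a formal power series in `k` variables: the
coefficient of `y_1^{i_1} … y_k^{i_k}` is `V(1^{i_1} … k^{i_k})`. -/
noncomputable def gzGenFun (k : ℕ) : MvPowerSeries (Fin k) ℚ :=
  fun i => (gzVertexCount (fun j => i j) : ℚ)

/-- `s` is the formal square root of `f` with constant term `1`. -/
def IsFormalSqrt {σ : Type*} (f s : MvPowerSeries σ ℚ) : Prop :=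
  s ^ 2 = f ∧ MvPowerSeries.constantCoeff s = 1

/-! A point of the polytope is a vertex exactly when every entry equals one of its two upper
neighbours (`extremePoints_gzPolytope`), so vertices are counted by choosing the first row and
recursing (`ncard_gzVertices_succ`). Below a row 1^k 2^l 3^m only the entries under a jump are free,
which gives the recurrences `gzCount₃_zero_middle` and `gzCount₃_succ_middle`.

Put K = (x+y)(y+z) - y. The second recurrence says that K G has degree at most 1 in y, and the first
that its y-free part is xz/(1-x-z). The coefficient of y is found by the kernel method: K = (y -
Y₊)(y - Y₋) with Y± = (1-x-z ± s)/2. The series Y₊/((1-x-z)(Y₊-y)) exists because Y₊ has constant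
term 1, and K times it has the same shape as K G. The difference is killed by
`eq_zero_of_kernel_mul`, which replaces the usual substitution y = Y₋. -/

namespace MvPowerSeries

/-! ### Coefficients in three variables and formal square roots -/

/-- The coefficient of `x^k y^l z^m` in a power series in three variables. -/
noncomputable def coeff₃ (k l m : ℕ) : MvPowerSeries (Fin 3) ℚ →ₗ[ℚ] ℚ :=
  coeff (Finsupp.single 0 k + Finsupp.single 1 l + Finsupp.single 2 m)

theorem ext_coeff₃ {f g : MvPowerSeries (Fin 3) ℚ}
    (h : ∀ k l m, coeff₃ k l m f = coeff₃ k l m g) : f = g := by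
  ext n
  have hn : n = Finsupp.single 0 (n 0) + Finsupp.single 1 (n 1) + Finsupp.single 2 (n 2) := by
    ext i
    fin_cases i <;> simp
  rw [hn]
  exact h _ _ _

theorem coeff₃_X_zero_mul (k l m : ℕ) (f : MvPowerSeries (Fin 3) ℚ) :
    coeff₃ k l m (X 0 * f) = if k = 0 then 0 else coeff₃ (k - 1) l m f := by
  unfold coeff₃ X
  rw [coeff_monomial_mul]
  rcases k with _ | k
  · rw [if_neg (fun h => by simpa using h 0), if_pos rfl]
  · rw [if_pos (Finsupp.le_def.mpr fun i => by fin_cases i <;> simp), if_neg (Nat.succ_ne_zero k), one_mul]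
    congr 2
    ext i
    fin_cases i <;> simp

theorem coeff₃_X_one_mul (k l m : ℕ) (f : MvPowerSeries (Fin 3) ℚ) :
    coeff₃ k l m (X 1 * f) = if l = 0 then 0 else coeff₃ k (l - 1) m f := by
  unfold coeff₃ X
  rw [coeff_monomial_mul]
  rcases l with _ | l
  · rw [if_neg (fun h => by simpa using h 1), if_pos rfl]
  · rw [if_pos (Finsupp.le_def.mpr fun i => by fin_cases i <;> simp), if_neg (Nat.succ_ne_zero l), one_mul]
    congr 2
    ext i
    fin_cases i <;> simp

theorem coeff₃_X_two_mul (k l m : ℕ) (f : MvPowerSeries (Fin 3) ℚ) :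
    coeff₃ k l m (X 2 * f) = if m = 0 then 0 else coeff₃ k l (m - 1) f := by
  unfold coeff₃ X
  rw [coeff_monomial_mul]
  rcases m with _ | m
  · rw [if_neg (fun h => by simpa using h 2), if_pos rfl]
  · rw [if_pos (Finsupp.le_def.mpr fun i => by fin_cases i <;> simp), if_neg (Nat.succ_ne_zero m), one_mul]
    congr 2
    ext i
    fin_cases i <;> simp

theorem coeff₃_one (k l m : ℕ) :
    coeff₃ k l m 1 = if k = 0 ∧ l = 0 ∧ m = 0 then 1 else 0 := by
  unfold coeff₃
  rw [coeff_one]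
  congr 1
  simp only [eq_iff_iff]
  refine ⟨fun h => ⟨?_, ?_, ?_⟩, ?_⟩
  · simpa using DFunLike.congr_fun h 0
  · simpa using DFunLike.congr_fun h 1
  · simpa using DFunLike.congr_fun h 2
  · rintro ⟨rfl, rfl, rfl⟩
    simp

theorem coeff₃_of_pderiv_eq_zero {f : MvPowerSeries (Fin 3) ℚ} (hf : pderiv ℚ 1 f = 0)
    (k l m : ℕ) : coeff₃ k (l + 1) m f = 0 := by
  have h := congrArg (coeff₃ k l m) hf
  unfold coeff₃ at h ⊢
  rw [coeff_pderiv, map_zero, mul_eq_zero] at h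
  rcases h with h | h
  · rw [← h]
    congr 2
    ext i
    fin_cases i <;> simp
  · have : (0 : ℚ) ≤ ((Finsupp.single 0 k + Finsupp.single 1 l + Finsupp.single 2 m :
      Fin 3 →₀ ℕ) 1 : ℚ) := Nat.cast_nonneg _
    linarith

/-- A power series over `ℚ` with constant term `1` has a formal square root. -/
theorem exists_isFormalSqrt {σ : Type*} {f : MvPowerSeries σ ℚ} (hf : constantCoeff f = 1) :
    ∃ s, IsFormalSqrt f s := by
  have hg : constantCoeff (f - 1) = 0 := by simp [hf]
  have hs := PowerSeries.HasSubst.of_constantCoeff_zero hg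
  let b : PowerSeries ℚ := PowerSeries.binomialSeries ℚ (1 / 2 : ℚ)
  have hb : b * b = 1 + PowerSeries.X := by
    rw [← PowerSeries.binomialSeries_add, show (1 / 2 + 1 / 2 : ℚ) = ((1 : ℕ) : ℚ) by norm_num,
      PowerSeries.binomialSeries_nat, pow_one]
  have hsq : b.subst (f - 1) ^ 2 = f := by
    rw [sq, ← PowerSeries.subst_mul hs, hb, ← PowerSeries.coe_substAlgHom hs, map_add, map_one,
      PowerSeries.substAlgHom_X hs]
    ring
  have hc : constantCoeff (b.subst (f - 1)) ^ 2 = 1 := by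
    rw [← map_pow, hsq, hf]
  -- Knowing the square fixes the constant term only up to sign; negate if needed.
  rcases (by simpa using hc : constantCoeff (b.subst (f - 1)) = 1 ∨ constantCoeff (b.subst (f - 1)) = -1) with h | h
  · exact ⟨_, hsq, h⟩
  · exact ⟨-b.subst (f - 1), by rw [neg_sq, hsq], by rw [map_neg, h, neg_neg]⟩

theorem isFormalSqrt_unique {σ : Type*} {f s t : MvPowerSeries σ ℚ}
    (hs : IsFormalSqrt f s) (ht : IsFormalSqrt f t) : s = t := by
  rcases sq_eq_sq_iff_eq_or_eq_neg.mp (hs.1.trans ht.1.symm) with h | h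
  · exact h
  · have := congrArg constantCoeff h
    rw [map_neg, hs.2, ht.2] at this
    norm_num at this

theorem two_ne_zero_of_rat {σ : Type*} : (2 : MvPowerSeries σ ℚ) ≠ 0 := by
  intro h
  have := congrArg constantCoeff h
  rw [map_ofNat, map_zero] at this
  norm_num at this

/-- Differentiating s² = f gives 2 s s' = 0 in a domain. It is used to see that the square root does
not involve y. -/
theorem pderiv_eq_zero_of_isFormalSqrt {σ : Type*} {f s : MvPowerSeries σ ℚ} {i : σ}
    (hs : IsFormalSqrt f s) (hf : pderiv ℚ i f = 0) : pderiv ℚ i s = 0 := by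
  have hs0 : s ≠ 0 := by
    rintro rfl
    simpa using hs.2
  rw [← hs.1, pderiv_pow] at hf
  have h2 : (2 : MvPowerSeries σ ℚ) ≠ 0 := two_ne_zero_of_rat
  simpa [hs0, h2] using hf

/-! ### The kernel method -/

/-- The kernel `(x + y) (y + z) - y` annihilates only the zero series, even modulo multiples
of `y` by a series without `y`. -/
theorem eq_zero_of_kernel_mul {E Q : MvPowerSeries (Fin 3) ℚ}
    (h : ((X 0 + X 1) * (X 1 + X 2) - X 1) * E = Q)
    (hQ₀ : ∀ k m, coeff₃ k 0 m Q = 0) (hQ₂ : ∀ k l m, coeff₃ k (l + 2) m Q = 0) : E = 0 := by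
  have hexp : X 1 * (X 1 * E) + X 0 * (X 1 * E) + X 1 * (X 2 * E) + X 0 * (X 2 * E) - X 1 * E
      = Q := by rw [← h]; ring
  have key : ∀ N k l m, k + l + m = N → coeff₃ k l m E = 0 := by
    intro N
    induction N using Nat.strong_induction_on with
    | _ N ih =>
      intro k l m hN
      -- The y-free part of the kernel is xz, which isolates a y-free coefficient of E. Otherwise
      -- use -y, the only linear term of the kernel: the quadratic terms involve coefficients of E
      -- of smaller total degree.
      rcases l with _ | l
      · have := hQ₀ (k + 1) (m + 1)
        rw [← hexp] at this
        simpa [coeff₃_X_zero_mul, coeff₃_X_one_mul, coeff₃_X_two_mul] using this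
      · have h2 := hQ₂ k l m
        rw [← hexp] at h2
        simp only [map_add, map_sub, coeff₃_X_zero_mul, coeff₃_X_one_mul, coeff₃_X_two_mul] at h2
        have e1 : coeff₃ k l m E = 0 := ih (k + l + m) (by omega) k l m rfl
        have e2 : k ≠ 0 → coeff₃ (k - 1) (l + 1) m E = 0 := fun hk =>
          ih (k - 1 + (l + 1) + m) (by omega) _ _ _ rfl
        have e3 : m ≠ 0 → coeff₃ k (l + 1) (m - 1) E = 0 := fun hk =>
          ih (k + (l + 1) + (m - 1)) (by omega) _ _ _ rfl
        have e4 : k ≠ 0 → m ≠ 0 → coeff₃ (k - 1) (l + 2) (m - 1) E = 0 := fun hk hm =>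
          ih (k - 1 + (l + 2) + (m - 1)) (by omega) _ _ _ rfl
        have a1 : l + 2 - 1 = l + 1 := rfl
        have a2 : l + 1 - 1 = l := rfl
        simp only [a1, a2, Nat.add_eq_zero_iff, OfNat.ofNat_ne_zero, one_ne_zero, and_false,
          if_false, e1] at h2
        by_cases hk : k = 0 <;> by_cases hm : m = 0 <;> simp_all
  exact ext_coeff₃ fun k l m => by rw [key _ k l m rfl, map_zero]

theorem kernel_mul_eq_of_recurrence {G s : MvPowerSeries (Fin 3) ℚ}
    (hs : IsFormalSqrt (1 - 2 * (X 0 + X 2) + (X 0 - X 2) ^ 2) s)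
    (hG₀ : ∀ k m, coeff₃ k 0 m G = (if k = 0 ∧ m = 0 then 1 else 0) +
      (if k = 0 then 0 else coeff₃ (k - 1) 0 m G) + (if m = 0 then 0 else coeff₃ k 0 (m - 1) G))
    (hG₁ : ∀ k l m, coeff₃ k (l + 1) m G = coeff₃ k l m G +
      (if k = 0 then 0 else coeff₃ (k - 1) (l + 1) m G) +
      (if m = 0 then 0 else coeff₃ k (l + 1) (m - 1) G) +
      (if k = 0 then 0 else if m = 0 then 0 else coeff₃ (k - 1) (l + 2) (m - 1) G)) :
    G * (2 * (1 - X 0 - X 2) * ((X 0 + X 1) * (X 1 + X 2) - X 1)) =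
      2 * X 0 * X 2 - X 1 * (1 - X 0 - X 2) - X 1 * s := by
  have hder : pderiv ℚ 1 (1 - 2 * (X 0 + X 2) + (X 0 - X 2) ^ 2 : MvPowerSeries (Fin 3) ℚ) = 0 := by
    have h0 : pderiv ℚ 1 (X 0 : MvPowerSeries (Fin 3) ℚ) = 0 := pderiv_X_of_ne (by decide)
    have h2 : pderiv ℚ 1 (X 2 : MvPowerSeries (Fin 3) ℚ) = 0 := pderiv_X_of_ne (by decide)
    simp only [two_mul, map_add, map_sub, pderiv_pow, pderiv_one, h0, h2]
    simp
  have hsy : ∀ k l m, coeff₃ k (l + 1) m s = 0 :=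
    coeff₃_of_pderiv_eq_zero (pderiv_eq_zero_of_isFormalSqrt hs hder)
  set x : MvPowerSeries (Fin 3) ℚ := X 0 with hx
  set y : MvPowerSeries (Fin 3) ℚ := X 1 with hy
  set z : MvPowerSeries (Fin 3) ℚ := X 2 with hz
  have hcx : constantCoeff x = 0 := constantCoeff_X 0
  have hcy : constantCoeff y = 0 := constantCoeff_X 1
  have hcz : constantCoeff z = 0 := constantCoeff_X 2
  -- The inverted factor is 2(Y₊ - y), of constant term 2.
  obtain ⟨w, hw⟩ : ∃ w, (1 - x - z + s - 2 * y) * w = 1 := by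
    have : IsUnit (1 - x - z + s - 2 * y) := by
      rw [isUnit_iff_constantCoeff]
      simp [hcx, hcy, hcz, hs.2]
    exact this.exists_right_inv
  have hs2 : s ^ 2 = 1 - 2 * (x + z) + (x - z) ^ 2 := hs.1
  have h2 : (2 : MvPowerSeries (Fin 3) ℚ) ≠ 0 := two_ne_zero_of_rat
  obtain ⟨M, hMG⟩ : ∃ M, M = ((x + y) * (y + z) - y) * G := ⟨_, rfl⟩
  have hM : M = y * (y * G) + x * (y * G) + y * (z * G) + x * (z * G) - y * G := by
    rw [hMG]; ring
  have hM₀ : ∀ k m, coeff₃ k 0 m M =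
      if k = 0 then 0 else if m = 0 then 0 else coeff₃ (k - 1) 0 (m - 1) G := by
    intro k m
    rw [hM]
    simp [hx, hy, hz, coeff₃_X_zero_mul, coeff₃_X_one_mul, coeff₃_X_two_mul]
  have hM₂ : ∀ k l m, coeff₃ k (l + 2) m M = 0 := by
    intro k l m
    have hl : l + 2 - 1 = l + 1 := rfl
    rw [hM]
    simp only [map_add, map_sub, hx, hy, hz, coeff₃_X_zero_mul, coeff₃_X_one_mul,
      coeff₃_X_two_mul, hl]
    simp only [Nat.add_eq_zero_iff, OfNat.ofNat_ne_zero, one_ne_zero, and_false, if_false, hG₁ k l m,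
      Nat.add_sub_cancel]
    ring
  -- The subtracted term is 2(1-x-z) times the candidate Y₊/((1-x-z)(Y₊-y)).
  have hE : 2 * (1 - x - z) * G - 2 * (1 - x - z + s) * w = 0 := by
    -- Here Q is 2(1-x-z)M minus the claimed numerator, expanded so that its coefficients can be
    -- read off.
    refine eq_zero_of_kernel_mul
      (Q := (2 : ℚ) • (M - x * M - z * M - x * (z * 1)) + (y * 1 - y * (x * 1) - y * (z * 1)
        + y * s)) ?_ ?_ ?_
    · rw [← hx, ← hy, ← hz, hMG, show ∀ f : MvPowerSeries (Fin 3) ℚ, (2 : ℚ) • f = 2 * f from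
        fun f => by rw [two_smul, two_mul]]
      -- The factor 4 clears denominators in 4K = (2y-(1-x-z))² - s².
      refine mul_left_cancel₀ (mul_ne_zero h2 h2) ?_
      linear_combination (2 * (1 - x - z + s) * (2 * y - (1 - x - z) + s)) * hw +
        (2 - 2 * (1 - x - z + s) * w) * hs2
    · intro k m
      simp only [map_add, map_sub, map_smul, hx, hy, hz, coeff₃_X_zero_mul, coeff₃_X_one_mul,
        coeff₃_X_two_mul, coeff₃_one, hM₀, if_true, sub_zero, add_zero]
      rcases k with _ | k <;> rcases m with _ | m <;> simp
      rw [hG₀ k m]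
      ring
    · intro k l m
      have hl : l + 2 - 1 = l + 1 := rfl
      simp only [map_add, map_sub, map_smul, hx, hy, hz, coeff₃_X_zero_mul, coeff₃_X_one_mul,
        coeff₃_X_two_mul, coeff₃_one, hM₂, hsy, hl]
      simp
  refine mul_left_cancel₀ (mul_ne_zero h2 h2) ?_
  linear_combination 4 * ((x + y) * (y + z) - y) * hE -
    (2 * (1 - x - z + s) * (2 * y - (1 - x - z) + s)) * hw - (2 - 2 * (1 - x - z + s) * w) * hs2
end MvPowerSeries

/-! ### Vertices of the polytope -/

/-- The triangular table with top row `lam` and further rows `u`, extended by zero. -/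
noncomputable def gzTable {n : ℕ} (lam : Fin n → ℤ) (u : GZIndex n → ℝ) (i j : ℕ) : ℝ :=
  if h : 1 ≤ i ∧ 1 ≤ j ∧ i + j ≤ n then u ⟨(i, j), h⟩
  else if h : i = 0 ∧ 1 ≤ j ∧ j ≤ n then (lam ⟨j - 1, by omega⟩ : ℝ) else 0

theorem gzTable_of_one_le {n : ℕ} (lam : Fin n → ℤ) (u : GZIndex n → ℝ) {i j : ℕ}
    (h : 1 ≤ i ∧ 1 ≤ j ∧ i + j ≤ n) : gzTable lam u i j = u ⟨(i, j), h⟩ := dif_pos h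

theorem gzTable_zero {n : ℕ} (lam : Fin n → ℤ) (u : GZIndex n → ℝ) {j : ℕ}
    (h : 1 ≤ j ∧ j ≤ n) : gzTable lam u 0 j = lam ⟨j - 1, by omega⟩ := by
  rw [gzTable, dif_neg (by omega), dif_pos ⟨rfl, h⟩]

theorem mem_gzPolytope_iff {n : ℕ} {lam : Fin n → ℤ} {u : GZIndex n → ℝ} :
    u ∈ gzPolytope lam ↔ ∀ i j, 1 ≤ j → i + 1 + j ≤ n →
      gzTable lam u i j ≤ gzTable lam u (i + 1) j ∧
        gzTable lam u (i + 1) j ≤ gzTable lam u i (j + 1) := by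
  constructor
  · rintro ⟨h1, h2⟩ i j hj hn
    rcases i with _ | i
    · rw [gzTable_zero _ _ (by omega), gzTable_zero _ _ (by omega),
        gzTable_of_one_le _ _ (by omega)]
      exact h1 j hj (by omega)
    · rw [gzTable_of_one_le _ _ (by omega), gzTable_of_one_le _ _ (by omega),
        gzTable_of_one_le _ _ (by omega)]
      exact h2 (i + 1) j (by omega) hj hn
  · intro h
    refine ⟨fun j hj hn => ?_, fun i j hi hj hn => ?_⟩
    · have := h 0 j hj (by omega)
      rwa [gzTable_zero _ _ (by omega), gzTable_zero _ _ (by omega),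
        gzTable_of_one_le _ _ (by omega)] at this
    · have := h i j hj hn
      rwa [gzTable_of_one_le _ _ (by omega), gzTable_of_one_le _ _ (by omega),
        gzTable_of_one_le _ _ (by omega)] at this

/-- Rows of a table in the Gelfand-Zetlin polytope are non-decreasing. -/
theorem gzTable_le_of_le {n : ℕ} {lam : Fin n → ℤ} {u : GZIndex n → ℝ} (hu : u ∈ gzPolytope lam)
    {i j j' : ℕ} (hj : 1 ≤ j) (hjj : j ≤ j') (hn : i + j' ≤ n) :
    gzTable lam u i j ≤ gzTable lam u i j' := by
  induction j', hjj using Nat.le_induction with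
  | base => exact le_rfl
  | succ k hk ih =>
    have := mem_gzPolytope_iff.mp hu i k (by omega) (by omega)
    exact (ih (by omega)).trans (this.1.trans this.2)

/-- The points of the Gelfand-Zetlin polytope all of whose coordinates are equal to one of their
upper neighbours. -/
def gzVertices {n : ℕ} (lam : Fin n → ℤ) : Set (GZIndex n → ℝ) :=
  {u | u ∈ gzPolytope lam ∧ ∀ i j, 1 ≤ j → i + 1 + j ≤ n →
    gzTable lam u (i + 1) j = gzTable lam u i j ∨
      gzTable lam u (i + 1) j = gzTable lam u i (j + 1)}

/-- Going down the rows, each entry is an endpoint of the interval allowed by its upper neighbours,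
and an endpoint is not a proper convex combination of other points of the interval. -/
theorem gzVertices_subset_extremePoints {n : ℕ} (lam : Fin n → ℤ) :
    gzVertices lam ⊆ Set.extremePoints ℝ (gzPolytope lam) := by
  rintro u ⟨hu, hv⟩
  rw [mem_extremePoints_iff_left]
  refine ⟨hu, fun v hvP w hwP ⟨a, b, ha, hb, hab, huvw⟩ => ?_⟩
  have key : ∀ i j, 1 ≤ j → i + j ≤ n → gzTable lam v i j = gzTable lam u i j ∧
      gzTable lam w i j = gzTable lam u i j := by
    intro i
    induction i with
    | zero =>
      intro j hj hn
      simp only [gzTable_zero _ _ (show 1 ≤ j ∧ j ≤ n by omega), and_self]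
    | succ i ih =>
      intro j hj hn
      have hidx : 1 ≤ i + 1 ∧ 1 ≤ j ∧ i + 1 + j ≤ n := by omega
      have hcomb : a * gzTable lam v (i + 1) j + b * gzTable lam w (i + 1) j =
          gzTable lam u (i + 1) j := by
        rw [gzTable_of_one_le _ _ hidx, gzTable_of_one_le _ _ hidx, gzTable_of_one_le _ _ hidx,
          ← huvw]
        rfl
      have hv1 := mem_gzPolytope_iff.mp hvP i j hj hn
      have hw1 := mem_gzPolytope_iff.mp hwP i j hj hn
      obtain ⟨e1, e2⟩ := ih j hj (by omega)
      obtain ⟨e3, e4⟩ := ih (j + 1) (by omega) (by omega)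
      rw [e1, e3] at hv1
      rw [e2, e4] at hw1
      have hb' : b = 1 - a := by linarith
      subst hb'
      rcases hv i j hj hn with h | h <;> rw [h] at hcomb ⊢
      · constructor <;> nlinarith
      · constructor <;> nlinarith
  funext ⟨⟨i, j⟩, h⟩
  have := (key i j h.2.1 h.2.2).1
  rwa [gzTable_of_one_le _ _ h, gzTable_of_one_le _ _ h] at this

/-- If an entry v lies strictly between its upper neighbours, all entries equal to v from that row
downwards can be moved together by ±ε, so the point is a midpoint. -/
theorem extremePoints_subset_gzVertices {n : ℕ} (lam : Fin n → ℤ) :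
    Set.extremePoints ℝ (gzPolytope lam) ⊆ gzVertices lam := by
  intro u hu
  rw [mem_extremePoints_iff_left] at hu
  obtain ⟨huP, hext⟩ := hu
  refine ⟨huP, fun p q hq hn => ?_⟩
  by_contra! hne
  have hP := mem_gzPolytope_iff.mp huP
  set T := gzTable lam u with hT
  set v := T (p + 1) q with hv
  have hl : T p q < v := lt_of_le_of_ne (hP p q hq hn).1 (Ne.symm hne.1)
  have hr : v < T p (q + 1) := lt_of_le_of_ne (hP p q hq hn).2 hne.2
  -- The row above omits v, so no entry that moves has a fixed upper neighbour of the same value.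
  have hrow : ∀ j, 1 ≤ j → p + j ≤ n → T p j ≠ v := by
    intro j hj hjn
    rcases le_or_gt j q with h | h
    · exact ((gzTable_le_of_le huP hj h (by omega)).trans_lt hl).ne
    · exact (hr.trans_le (gzTable_le_of_le huP (by omega) h hjn)).ne'
  -- Take ε at most the distance from v to every other value in the table.
  obtain ⟨ε, hε, hgap⟩ : ∃ ε > 0, ∀ a b : Fin (n + 2), T a b ≠ v → ε ≤ |T a b - v| := by
    have : ∀ᶠ ε in nhdsWithin (0 : ℝ) (Set.Ioi 0),
        ∀ a b : Fin (n + 2), T a b ≠ v → ε ≤ |T a b - v| := by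
      rw [Filter.eventually_all]
      intro a
      rw [Filter.eventually_all]
      intro b
      by_cases h : T a b = v
      · simp [h]
      · have hpos : 0 < |T a b - v| := abs_pos.mpr (sub_ne_zero.mpr h)
        filter_upwards [Ioo_mem_nhdsGT hpos] with ε hε _ using hε.2.le
    obtain ⟨ε, h1, h2⟩ := (this.and self_mem_nhdsWithin).exists
    exact ⟨ε, h2, h1⟩
  have hgap' : ∀ i j, i + j ≤ n → T i j ≠ v → ε ≤ |T i j - v| := fun i j hij h =>
    hgap ⟨i, by omega⟩ ⟨j, by omega⟩ h
  let d : GZIndex n → ℝ := fun g => if p + 1 ≤ g.1.1 ∧ u g = v then 1 else 0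
  have htab : ∀ c : ℝ, ∀ i j, 1 ≤ j → i + j ≤ n →
      gzTable lam (u + c • d) i j = T i j + c * (if p + 1 ≤ i ∧ T i j = v then 1 else 0) := by
    intro c i j hj hij
    rcases i with _ | i
    · rw [hT, gzTable_zero _ _ (by omega), gzTable_zero _ _ (by omega), if_neg (by omega)]
      simp
    · have hidx : 1 ≤ i + 1 ∧ 1 ≤ j ∧ i + 1 + j ≤ n := by omega
      rw [hT, gzTable_of_one_le _ _ hidx, gzTable_of_one_le _ _ hidx]
      rfl
  have hmem : ∀ c : ℝ, |c| ≤ ε → u + c • d ∈ gzPolytope lam := by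
    intro c hc
    rw [mem_gzPolytope_iff]
    have hstep : ∀ i j i' j', 1 ≤ j → i + j ≤ n → 1 ≤ j' → i' + j' ≤ n → T i j ≤ T i' j' →
        (i' = i + 1 ∨ i = i' + 1) →
        gzTable lam (u + c • d) i j ≤ gzTable lam (u + c • d) i' j' := by
      intro i j i' j' hj hij hj' hij' hle hii
      rw [htab c i j hj hij, htab c i' j' hj' hij']
      have hc' := abs_le.mp hc
      by_cases e : T i j = v
      · by_cases e' : T i' j' = v
        · have h1 : i ≠ p := fun h => hrow j hj (h ▸ hij) (h ▸ e)
          have h2 : i' ≠ p := fun h => hrow j' hj' (h ▸ hij') (h ▸ e')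
          have : p + 1 ≤ i ↔ p + 1 ≤ i' := by omega
          simp [e, e', this]
        · have := hgap' i' j' hij' e'
          rw [abs_of_nonneg (by linarith)] at this
          simp only [e', and_false, if_false]
          split_ifs <;> linarith
      · have h3 := hgap' i j hij e
        by_cases e' : T i' j' = v
        · rw [abs_of_nonpos (by linarith)] at h3
          simp only [e, and_false, if_false]
          split_ifs <;> linarith
        · simpa [e, e'] using hle
    intro i j hj hij
    exact ⟨hstep i j (i + 1) j hj (by omega) hj hij (hP i j hj hij).1 (Or.inl rfl),
      hstep (i + 1) j i (j + 1) hj hij (by omega) (by omega) (hP i j hj hij).2 (Or.inr rfl)⟩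
  have heq := hext (u + ε • d) (hmem ε (abs_of_pos hε).le) (u + (-ε) • d)
    (hmem (-ε) (by rw [abs_neg, abs_of_pos hε]))
    ⟨1 / 2, 1 / 2, by norm_num, by norm_num, by norm_num, by
      ext g
      simp only [Pi.add_apply, Pi.smul_apply, smul_eq_mul]
      ring⟩
  have hidx : 1 ≤ p + 1 ∧ 1 ≤ q ∧ p + 1 + q ≤ n := by omega
  have hval := congrFun heq ⟨(p + 1, q), hidx⟩
  have huv : u ⟨(p + 1, q), hidx⟩ = v := (gzTable_of_one_le lam u hidx).symm
  simp [d, huv] at hval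
  exact hε.ne' hval

theorem extremePoints_gzPolytope {n : ℕ} (lam : Fin n → ℤ) :
    Set.extremePoints ℝ (gzPolytope lam) = gzVertices lam :=
  (extremePoints_subset_gzVertices lam).antisymm (gzVertices_subset_extremePoints lam)

/-! ### Recursion on the first row -/

/-- The table with first row `μ`, followed by the rows of `w`. -/
noncomputable def gzGlue {n : ℕ} (μ : Fin n → ℤ) (w : GZIndex n → ℝ) : GZIndex (n + 1) → ℝ :=
  fun g => gzTable μ w (g.1.1 - 1) g.1.2

theorem gzTable_gzGlue {n : ℕ} (lam : Fin (n + 1) → ℤ) (μ : Fin n → ℤ) (w : GZIndex n → ℝ)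
    {i j : ℕ} (hj : 1 ≤ j) (hij : i + j ≤ n) :
    gzTable lam (gzGlue μ w) (i + 1) j = gzTable μ w i j := by
  rw [gzTable_of_one_le _ _ (by omega)]
  rfl

/-- The integral rows of length `n`, each of whose entries is equal to one of its upper neighbours
in `lam`. -/
def gzRows {n : ℕ} (lam : Fin (n + 1) → ℤ) : Finset (Fin n → ℤ) :=
  Fintype.piFinset fun j => {lam j.castSucc, lam j.succ}

theorem mem_gzRows {n : ℕ} {lam : Fin (n + 1) → ℤ} {μ : Fin n → ℤ} :
    μ ∈ gzRows lam ↔ ∀ j : Fin n, μ j = lam j.castSucc ∨ μ j = lam j.succ := by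
  simp [gzRows]

theorem gzGlue_mem_gzVertices {n : ℕ} {lam : Fin (n + 1) → ℤ} (hlam : Monotone lam)
    {μ : Fin n → ℤ} (hμ : μ ∈ gzRows lam) {w : GZIndex n → ℝ} :
    gzGlue μ w ∈ gzVertices lam ↔ w ∈ gzVertices μ := by
  constructor
  · rintro ⟨hP, hV⟩
    rw [mem_gzPolytope_iff] at hP
    refine ⟨mem_gzPolytope_iff.mpr fun i j hj hn => ?_, fun i j hj hn => ?_⟩
    · have := hP (i + 1) j hj (by omega)
      rwa [gzTable_gzGlue _ _ _ hj (by omega), gzTable_gzGlue _ _ _ hj (by omega),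
        gzTable_gzGlue _ _ _ (by omega) (by omega)] at this
    · have := hV (i + 1) j hj (by omega)
      rwa [gzTable_gzGlue _ _ _ hj (by omega), gzTable_gzGlue _ _ _ hj (by omega),
        gzTable_gzGlue _ _ _ (by omega) (by omega)] at this
  · rintro ⟨hP, hV⟩
    rw [mem_gzPolytope_iff] at hP
    refine ⟨mem_gzPolytope_iff.mpr fun i j hj hn => ?_, fun i j hj hn => ?_⟩
    · rcases i with _ | i
      · rw [gzTable_gzGlue _ _ _ hj (by omega), gzTable_zero _ _ (by omega),
          gzTable_zero _ _ (by omega), gzTable_zero _ _ (by omega)]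
        obtain ⟨j, rfl⟩ : ∃ t, j = t + 1 := ⟨j - 1, by omega⟩
        have hle : lam (Fin.castSucc ⟨j, by omega⟩) ≤ lam (Fin.succ ⟨j, by omega⟩) :=
          hlam (Fin.castSucc_le_succ _)
        have h1 : lam (Fin.castSucc ⟨j, by omega⟩) ≤ μ ⟨j, by omega⟩ ∧
            μ ⟨j, by omega⟩ ≤ lam (Fin.succ ⟨j, by omega⟩) := by
          rcases mem_gzRows.mp hμ ⟨j, by omega⟩ with h | h <;> rw [h] <;>
            exact ⟨by first | exact le_rfl | exact hle, by first | exact le_rfl | exact hle⟩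
        exact ⟨by exact_mod_cast h1.1, by exact_mod_cast h1.2⟩
      · rw [gzTable_gzGlue _ _ _ hj (by omega), gzTable_gzGlue _ _ _ hj (by omega),
          gzTable_gzGlue _ _ _ (by omega) (by omega)]
        exact hP i j hj (by omega)
    · rcases i with _ | i
      · rw [gzTable_gzGlue _ _ _ hj (by omega), gzTable_zero _ _ (by omega),
          gzTable_zero _ _ (by omega), gzTable_zero _ _ (by omega)]
        obtain ⟨j, rfl⟩ : ∃ t, j = t + 1 := ⟨j - 1, by omega⟩
        exact (mem_gzRows.mp hμ ⟨j, by omega⟩).imp (congrArg _) (congrArg _)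
      · rw [gzTable_gzGlue _ _ _ hj (by omega), gzTable_gzGlue _ _ _ hj (by omega),
          gzTable_gzGlue _ _ _ (by omega) (by omega)]
        exact hV i j hj (by omega)

theorem gzGlue_injective {n : ℕ} (μ : Fin n → ℤ) : Function.Injective (gzGlue μ) := by
  intro w w' h
  funext ⟨⟨i, j⟩, hg⟩
  have := congrFun h ⟨(i + 1, j), by dsimp only at hg ⊢; omega⟩
  change gzTable μ w i j = gzTable μ w' i j at this
  rwa [gzTable_of_one_le _ _ hg, gzTable_of_one_le _ _ hg] at this

theorem eq_of_gzGlue_eq {n : ℕ} {μ μ' : Fin n → ℤ} {w w' : GZIndex n → ℝ}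
    (h : gzGlue μ w = gzGlue μ' w') : μ = μ' := by
  funext ⟨j, hj⟩
  have := congrFun h ⟨(1, j + 1), by dsimp only; omega⟩
  change gzTable μ w 0 (j + 1) = gzTable μ' w' 0 (j + 1) at this
  rw [gzTable_zero _ _ (by omega), gzTable_zero _ _ (by omega)] at this
  exact_mod_cast this

theorem gzVertices_succ {n : ℕ} {lam : Fin (n + 1) → ℤ} (hlam : Monotone lam) :
    gzVertices lam = ⋃ μ ∈ (gzRows lam : Set (Fin n → ℤ)), gzGlue μ '' gzVertices μ := by
  ext u
  simp only [Set.mem_iUnion, Set.mem_image, exists_prop, Finset.mem_coe]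
  constructor
  · intro hu
    have hrow : ∀ j : Fin n, ∃ a : ℤ, (a : ℝ) = gzTable lam u 1 (j + 1) ∧
        (a = lam j.castSucc ∨ a = lam j.succ) := by
      intro j
      have := hu.2 0 (j + 1) (by omega) (by omega)
      rw [gzTable_zero _ _ (by omega), gzTable_zero _ _ (by omega)] at this
      rcases this with h | h
      · exact ⟨lam j.castSucc, h.symm, Or.inl rfl⟩
      · exact ⟨lam j.succ, h.symm, Or.inr rfl⟩
    choose μ hμ hμ' using hrow
    have hmem : μ ∈ gzRows lam := mem_gzRows.mpr hμ'
    let w : GZIndex n → ℝ := fun g => gzTable lam u (g.1.1 + 1) g.1.2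
    have hw : gzGlue μ w = u := by
      funext ⟨⟨i, j⟩, hg⟩
      change gzTable μ w (i - 1) j = _
      rw [← gzTable_of_one_le lam u hg]
      dsimp only at hg
      rcases Nat.lt_or_ge 1 i with h | h
      · rw [gzTable_of_one_le _ _ (by omega)]
        change gzTable lam u (i - 1 + 1) j = _
        rw [Nat.sub_add_cancel hg.1]
      · obtain rfl : i = 1 := by omega
        rw [Nat.sub_self, gzTable_zero _ _ (by omega), hμ]
        change gzTable lam u 1 (j - 1 + 1) = _
        rw [Nat.sub_add_cancel hg.2.1]
    exact ⟨μ, hmem, w, (gzGlue_mem_gzVertices hlam hmem).mp (hw ▸ hu), hw⟩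
  · rintro ⟨μ, hμ, w, hw, rfl⟩
    exact (gzGlue_mem_gzVertices hlam hμ).mpr hw

theorem gzRows_monotone {n : ℕ} {lam : Fin (n + 1) → ℤ} (hlam : Monotone lam) {μ : Fin n → ℤ}
    (hμ : μ ∈ gzRows lam) : Monotone μ := by
  rw [mem_gzRows] at hμ
  intro i j hij
  rcases hij.eq_or_lt with rfl | hlt
  · exact le_rfl
  · have h1 : μ i ≤ lam i.succ := by
      rcases hμ i with h | h <;> rw [h]
      exact hlam (Fin.castSucc_le_succ _)
    have h2 : lam j.castSucc ≤ μ j := by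
      rcases hμ j with h | h <;> rw [h]
      exact hlam (Fin.castSucc_le_succ _)
    exact h1.trans ((hlam (by rw [Fin.le_def]; simpa using hlt)).trans h2)

instance : IsEmpty (GZIndex 0) := ⟨fun g => by have := g.2; omega⟩

theorem gzVertices_zero (lam : Fin 0 → ℤ) : gzVertices lam = Set.univ := by
  refine Set.eq_univ_of_forall fun u => ⟨mem_gzPolytope_iff.mpr fun i j hj hn => ?_,
    fun i j hj hn => ?_⟩ <;> omega

theorem gzVertices_finite {n : ℕ} {lam : Fin n → ℤ} (hlam : Monotone lam) :
    (gzVertices lam).Finite := by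
  induction n with
  | zero => exact Set.toFinite _
  | succ n ih =>
    rw [gzVertices_succ hlam]
    exact (gzRows lam).finite_toSet.biUnion fun μ hμ => (ih (gzRows_monotone hlam hμ)).image _

/-- The recurrence for the number of vertices: sum over the possible first rows. -/
theorem ncard_gzVertices_succ {n : ℕ} {lam : Fin (n + 1) → ℤ} (hlam : Monotone lam) :
    (gzVertices lam).ncard = ∑ μ ∈ gzRows lam, (gzVertices μ).ncard := by
  rw [gzVertices_succ hlam, Set.Finite.ncard_biUnion (gzRows lam).finite_toSet, finsum_mem_coe_finset]
  · exact Finset.sum_congr rfl fun μ _ => Set.ncard_image_of_injective _ (gzGlue_injective μ)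
  · exact fun μ hμ => (gzVertices_finite (gzRows_monotone hlam hμ)).image _
  · intro μ _ μ' _ hne
    rw [Function.onFun, Set.disjoint_left]
    rintro _ ⟨w, _, rfl⟩ ⟨w', _, h⟩
    exact hne (eq_of_gzGlue_eq h).symm

/-! ### Recurrences for three blocks -/

/-- The sequence of `k` ones, `l` twos, and then threes. -/
def gzBlock (k l j : ℕ) : ℤ := if j < k then 1 else if j < k + l then 2 else 3

theorem gzBlock_monotone (k l : ℕ) : Monotone (gzBlock k l) := by
  intro i j hij
  unfold gzBlock
  split_ifs <;> omega

/-- The number of vertices of the Gelfand-Zetlin polytope of `n` numbers, the first `k` of which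
are `1`, the next `l` are `2`, and the others are `3`. -/
noncomputable def gzBlockCount (n k l : ℕ) : ℕ :=
  (gzVertices fun j : Fin n => gzBlock k l j).ncard

theorem gzBlockCount_zero (k l : ℕ) : gzBlockCount 0 k l = 1 := by
  rw [gzBlockCount, gzVertices_zero, Set.ncard_univ, Nat.card_unique]

theorem gzBlockCount_succ (n k l : ℕ) : gzBlockCount (n + 1) k l =
    ∑ μ ∈ gzRows fun j : Fin (n + 1) => gzBlock k l j, (gzVertices μ).ncard :=
  ncard_gzVertices_succ fun _ _ hij => gzBlock_monotone k l hij

theorem mem_gzRows_gzBlock {n k l : ℕ} {μ : Fin n → ℤ} :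
    (μ ∈ gzRows fun j : Fin (n + 1) => gzBlock k l j) ↔
      ∀ j (hj : j < n), μ ⟨j, hj⟩ = gzBlock k l j ∨ μ ⟨j, hj⟩ = gzBlock k l (j + 1) := by
  rw [mem_gzRows]
  exact ⟨fun h j hj => h ⟨j, hj⟩, fun h j => h j j.2⟩

theorem gzBlock_ne {n k₁ l₁ k₂ l₂ : ℕ} (j : ℕ) (hj : j < n)
    (h : gzBlock k₁ l₁ j ≠ gzBlock k₂ l₂ j) :
    (fun j : Fin n => gzBlock k₁ l₁ j) ≠ (fun j : Fin n => gzBlock k₂ l₂ j) :=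
  fun h' => h (congrFun h' ⟨j, hj⟩)

theorem eq_gzBlock_iff {n k l : ℕ} {μ : Fin n → ℤ} :
    (μ = fun j : Fin n => gzBlock k l j) ↔ ∀ j (hj : j < n), μ ⟨j, hj⟩ = gzBlock k l j := by
  rw [funext_iff, Fin.forall_iff]

/-- Counting from zero, only positions k and k+l+1 lie under a jump. Their independent choices 1 or
2, and 2 or 3, give the four rows. -/
theorem gzBlockCount_of_pos {n k l m : ℕ} (hn : n + 1 = (k + 1) + (l + 1) + (m + 1)) :
    gzBlockCount (n + 1) (k + 1) (l + 1) = gzBlockCount n (k + 1) (l + 1) +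
      gzBlockCount n (k + 1) l + gzBlockCount n k (l + 2) + gzBlockCount n k (l + 1) := by
  have hrows : (gzRows fun j : Fin (n + 1) => gzBlock (k + 1) (l + 1) j) =
      {(fun j : Fin n => gzBlock (k + 1) (l + 1) j), (fun j : Fin n => gzBlock (k + 1) l j),
        (fun j : Fin n => gzBlock k (l + 2) j), (fun j : Fin n => gzBlock k (l + 1) j)} := by
    ext μ
    simp only [mem_gzRows_gzBlock, Finset.mem_insert, Finset.mem_singleton, eq_gzBlock_iff]
    constructor
    · intro h
      have h1 := h k (by omega)
      have h2 := h (k + l + 1) (by omega)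
      -- Away from the two jumps both upper neighbours agree, so a row is determined by its entries
      -- at the jumps.
      have hp : ∀ (k' l' : ℕ), μ ⟨k, by omega⟩ = gzBlock k' l' k →
          μ ⟨k + l + 1, by omega⟩ = gzBlock k' l' (k + l + 1) →
          (∀ j, j ≠ k → j ≠ k + l + 1 → gzBlock k' l' j = gzBlock (k + 1) (l + 1) j ∧
            gzBlock k' l' j = gzBlock (k + 1) (l + 1) (j + 1)) →
          ∀ j (hj : j < n), μ ⟨j, hj⟩ = gzBlock k' l' j := by
        intro k' l' a b c j hj
        by_cases e1 : j = k
        · subst e1; exact a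
        · by_cases e2 : j = k + l + 1
          · subst e2; exact b
          · obtain ⟨c1, c2⟩ := c j e1 e2
            exact (h j hj).elim (fun h => h.trans c1.symm) (fun h => h.trans c2.symm)
      rcases h1 with h1 | h1 <;> rcases h2 with h2 | h2
      · exact Or.inl (hp _ _ (by rw [h1]) (by rw [h2])
          (by unfold gzBlock; intro j _ _; grind))
      · exact Or.inr (Or.inl (hp _ _ (by rw [h1]; unfold gzBlock; grind)
          (by rw [h2]; unfold gzBlock; grind) (by unfold gzBlock; intro j _ _; grind)))
      · exact Or.inr (Or.inr (Or.inl (hp _ _ (by rw [h1]; unfold gzBlock; grind)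
          (by rw [h2]; unfold gzBlock; grind) (by unfold gzBlock; intro j _ _; grind))))
      · exact Or.inr (Or.inr (Or.inr (hp _ _ (by rw [h1]; unfold gzBlock; grind)
          (by rw [h2]; unfold gzBlock; grind) (by unfold gzBlock; intro j _ _; grind))))
    · rintro (h | h | h | h) j hj <;> rw [h j hj] <;> unfold gzBlock <;> grind
  rw [gzBlockCount_succ, hrows, Finset.sum_insert, Finset.sum_insert, Finset.sum_insert,
    Finset.sum_singleton, ← add_assoc, ← add_assoc]
  · rfl
  · rw [Finset.mem_singleton]
    refine gzBlock_ne (k + l + 1) (by omega) ?_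
    unfold gzBlock; grind
  · simp only [Finset.mem_insert, Finset.mem_singleton, not_or]
    refine ⟨gzBlock_ne k (by omega) ?_, gzBlock_ne k (by omega) ?_⟩ <;> unfold gzBlock <;> grind
  · simp only [Finset.mem_insert, Finset.mem_singleton, not_or]
    refine ⟨gzBlock_ne (k + l + 1) (by omega) ?_, gzBlock_ne k (by omega) ?_,
      gzBlock_ne k (by omega) ?_⟩ <;> unfold gzBlock <;> grind

/-- If exactly one position `p` of the first row is free, there are two possible first rows. -/
theorem gzBlockCount_succ_of_pair {n k l k₁ l₁ k₂ l₂ : ℕ} (p : ℕ) (hp : p < n)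
    (hp₁ : gzBlock k₁ l₁ p = gzBlock k l p) (hp₂ : gzBlock k₂ l₂ p = gzBlock k l (p + 1))
    (hne : gzBlock k l p ≠ gzBlock k l (p + 1))
    (h : ∀ j < n, j ≠ p → gzBlock k l j = gzBlock k l (j + 1) ∧
      gzBlock k₁ l₁ j = gzBlock k l j ∧ gzBlock k₂ l₂ j = gzBlock k l j) :
    gzBlockCount (n + 1) k l = gzBlockCount n k₁ l₁ + gzBlockCount n k₂ l₂ := by
  have hrows : (gzRows fun j : Fin (n + 1) => gzBlock k l j) =
      {(fun j : Fin n => gzBlock k₁ l₁ j), (fun j : Fin n => gzBlock k₂ l₂ j)} := by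
    ext μ
    simp only [mem_gzRows_gzBlock, Finset.mem_insert, Finset.mem_singleton, eq_gzBlock_iff]
    constructor
    · intro hμ
      refine (hμ p hp).imp (fun hv j hj => ?_) (fun hv j hj => ?_) <;>
      · by_cases e : j = p
        · subst e
          rw [hv]
          first | exact hp₁.symm | exact hp₂.symm
        · obtain ⟨c1, c2, c3⟩ := h j hj e
          have := hμ j hj
          rw [← c1, or_self] at this
          rw [this]
          first | exact c2.symm | exact c3.symm
    · rintro (hμ | hμ) j hj <;> rw [hμ j hj] <;> by_cases e : j = p
      · exact Or.inl (e ▸ hp₁)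
      · exact Or.inl (h j hj e).2.1
      · exact Or.inr (e ▸ hp₂)
      · exact Or.inl (h j hj e).2.2
  rw [gzBlockCount_succ, hrows, Finset.sum_insert, Finset.sum_singleton]
  · rfl
  · rw [Finset.mem_singleton]
    exact gzBlock_ne p hp (by rwa [hp₁, hp₂])

/-- If the top row is constant, so is the first row. -/
theorem gzBlockCount_succ_of_const {n k l k₁ l₁ : ℕ}
    (h : ∀ j < n, gzBlock k l j = gzBlock k l (j + 1) ∧ gzBlock k₁ l₁ j = gzBlock k l j) :
    gzBlockCount (n + 1) k l = gzBlockCount n k₁ l₁ := by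
  have hrows : (gzRows fun j : Fin (n + 1) => gzBlock k l j) =
      {(fun j : Fin n => gzBlock k₁ l₁ j)} := by
    ext μ
    simp only [mem_gzRows_gzBlock, Finset.mem_singleton, eq_gzBlock_iff]
    refine forall₂_congr fun j hj => ?_
    rw [← (h j hj).1, or_self, (h j hj).2]
  rw [gzBlockCount_succ, hrows, Finset.sum_singleton]
  rfl

/-- The number of vertices of the Gelfand-Zetlin polytope of `1^k 2^l 3^m`. -/
noncomputable def gzCount₃ (k l m : ℕ) : ℕ := gzBlockCount (k + l + m) k l

/-- Without twos there is at most one jump, from 1 to 3. The isolated 1 is the empty sequence. -/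
theorem gzCount₃_zero_middle (k m : ℕ) : gzCount₃ k 0 m = (if k = 0 ∧ m = 0 then 1 else 0) +
    (if k = 0 then 0 else gzCount₃ (k - 1) 0 m) + (if m = 0 then 0 else gzCount₃ k 0 (m - 1)) := by
  unfold gzCount₃
  rcases k with _ | k <;> rcases m with _ | m
  · simp [gzBlockCount_zero]
  · simp only [Nat.succ_ne_zero, and_false, if_false, if_true, zero_add, Nat.add_sub_cancel]
    exact gzBlockCount_succ_of_const (by unfold gzBlock; intro j hj; grind)
  · simp only [Nat.succ_ne_zero, false_and, if_false, if_true, zero_add, add_zero,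
      Nat.add_sub_cancel]
    exact gzBlockCount_succ_of_const (by unfold gzBlock; intro j hj; grind)
  · simp only [Nat.succ_ne_zero, and_false, if_false, zero_add, add_zero, Nat.add_sub_cancel]
    rw [show k + 1 + (m + 1) = k + m + 1 + 1 by omega, show k + (m + 1) = k + m + 1 by omega,
      show k + 1 + m = k + m + 1 by omega, add_comm (gzBlockCount _ k 0)]
    apply gzBlockCount_succ_of_pair k (by omega) <;> unfold gzBlock <;> grind

/-- Each jump replaces one of its two values; choosing 2 at both jumps loses a 1 and a 3 and gains a
2. The conditionals drop the rows that need a missing block. -/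
theorem gzCount₃_succ_middle (k l m : ℕ) : gzCount₃ k (l + 1) m = gzCount₃ k l m +
    (if k = 0 then 0 else gzCount₃ (k - 1) (l + 1) m) +
    (if m = 0 then 0 else gzCount₃ k (l + 1) (m - 1)) +
    (if k = 0 then 0 else if m = 0 then 0 else gzCount₃ (k - 1) (l + 2) (m - 1)) := by
  unfold gzCount₃
  rcases k with _ | k <;> rcases m with _ | m
  · simp only [if_true, zero_add, add_zero]
    exact gzBlockCount_succ_of_const (by unfold gzBlock; intro j hj; grind)
  · simp only [Nat.succ_ne_zero, if_false, if_true, zero_add, add_zero, Nat.add_sub_cancel]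
    rw [show l + 1 + (m + 1) = l + m + 1 + 1 by omega, show l + (m + 1) = l + m + 1 by omega,
      show l + 1 + m = l + m + 1 by omega, add_comm (gzBlockCount _ 0 l)]
    apply gzBlockCount_succ_of_pair l (by omega) <;> unfold gzBlock <;> grind
  · simp only [Nat.succ_ne_zero, if_false, if_true, add_zero, Nat.add_sub_cancel]
    rw [show k + 1 + (l + 1) = k + l + 1 + 1 by omega, show k + (l + 1) = k + l + 1 by omega,
      show k + 1 + l = k + l + 1 by omega]
    apply gzBlockCount_succ_of_pair k (by omega) <;> unfold gzBlock <;> grind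
  · simp only [Nat.succ_ne_zero, if_false, Nat.add_sub_cancel]
    rw [show k + 1 + (l + 1) + (m + 1) = k + l + m + 2 + 1 by omega,
      show k + 1 + l + (m + 1) = k + l + m + 2 by omega,
      show k + (l + 1) + (m + 1) = k + l + m + 2 by omega,
      show k + 1 + (l + 1) + m = k + l + m + 2 by omega,
      show k + (l + 2) + m = k + l + m + 2 by omega,
      gzBlockCount_of_pos (m := m) (by omega)]
    ring

/-! ### The generating function -/

theorem ncard_gzVertices_get {L : List ℤ} {n : ℕ} (hL : L.length = n) {f : ℕ → ℤ}
    (hf : ∀ j (hj : j < L.length), L[j] = f j) :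
    (gzVertices L.get).ncard = (gzVertices fun j : Fin n => f j).ncard := by
  subst hL
  congr 2
  funext j
  exact hf j j.2

theorem gzVertexCount_three (i : Fin 3 → ℕ) : gzVertexCount i = gzCount₃ (i 0) (i 1) (i 2) := by
  have hL : multPartition i =
      List.replicate (i 0) 1 ++ (List.replicate (i 1) 2 ++ List.replicate (i 2) 3) := by
    simp [multPartition, List.ofFn_succ]
  rw [gzVertexCount, extremePoints_gzPolytope, gzCount₃, gzBlockCount]
  refine ncard_gzVertices_get (by simp [hL]; ring) fun j hj => ?_
  simp only [hL, List.getElem_append, List.length_replicate, List.getElem_replicate, gzBlock]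
  grind

theorem coeff₃_gzGenFun (k l m : ℕ) :
    MvPowerSeries.coeff₃ k l m (gzGenFun 3) = gzCount₃ k l m := by
  change ((gzVertexCount fun j => (Finsupp.single 0 k + Finsupp.single 1 l +
    Finsupp.single 2 m : Fin 3 →₀ ℕ) j : ℕ) : ℚ) = _
  rw [gzVertexCount_three]
  simp

/-- If the kernel were zero it would annihilate 1, against `eq_zero_of_kernel_mul`. -/
theorem gzGenFun_denominator_ne_zero :
    (2 * (1 - MvPowerSeries.X 0 - MvPowerSeries.X 2) *
      ((MvPowerSeries.X 0 + MvPowerSeries.X 1) * (MvPowerSeries.X 1 + MvPowerSeries.X 2) -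
        MvPowerSeries.X 1) : MvPowerSeries (Fin 3) ℚ) ≠ 0 := by
  refine mul_ne_zero (mul_ne_zero MvPowerSeries.two_ne_zero_of_rat fun h => ?_) fun h => ?_
  · have := congrArg MvPowerSeries.constantCoeff h
    simp at this
  · have := MvPowerSeries.eq_zero_of_kernel_mul (E := 1) (Q := 0) (by rw [h, zero_mul])
      (fun _ _ => map_zero _) (fun _ _ _ => map_zero _)
    exact one_ne_zero this

theorem theorem3 (x y z : MvPowerSeries (Fin 3) ℚ)
    (hx : x = MvPowerSeries.X 0) (hy : y = MvPowerSeries.X 1) (hz : z = MvPowerSeries.X 2) :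
    (2 * (1 - x - z) * ((x + y) * (y + z) - y) ≠ 0) ∧
    (∃! s : MvPowerSeries (Fin 3) ℚ, IsFormalSqrt (1 - 2 * (x + z) + (x - z) ^ 2) s) ∧
    (∀ s : MvPowerSeries (Fin 3) ℚ, IsFormalSqrt (1 - 2 * (x + z) + (x - z) ^ 2) s →
      algebraMap (MvPowerSeries (Fin 3) ℚ) (FractionRing (MvPowerSeries (Fin 3) ℚ)) (gzGenFun 3) =
        algebraMap (MvPowerSeries (Fin 3) ℚ) (FractionRing (MvPowerSeries (Fin 3) ℚ))
            (2 * x * z - y * (1 - x - z) - y * s) /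
          algebraMap (MvPowerSeries (Fin 3) ℚ) (FractionRing (MvPowerSeries (Fin 3) ℚ))
            (2 * (1 - x - z) * ((x + y) * (y + z) - y))) := by
  subst hx hy hz
  refine ⟨gzGenFun_denominator_ne_zero, ?_, fun s hs => ?_⟩
  · obtain ⟨s, hs⟩ := MvPowerSeries.exists_isFormalSqrt (σ := Fin 3)
      (f := 1 - 2 * (MvPowerSeries.X 0 + MvPowerSeries.X 2) +
        (MvPowerSeries.X 0 - MvPowerSeries.X 2) ^ 2) (by simp)
    exact ⟨s, hs, fun t ht => MvPowerSeries.isFormalSqrt_unique ht hs⟩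
  · have hne : algebraMap (MvPowerSeries (Fin 3) ℚ) (FractionRing (MvPowerSeries (Fin 3) ℚ))
        (2 * (1 - MvPowerSeries.X 0 - MvPowerSeries.X 2) *
          ((MvPowerSeries.X 0 + MvPowerSeries.X 1) * (MvPowerSeries.X 1 + MvPowerSeries.X 2) -
            MvPowerSeries.X 1)) ≠ 0 := by
      rw [Ne, IsFractionRing.to_map_eq_zero_iff]
      exact gzGenFun_denominator_ne_zero
    rw [eq_div_iff hne, ← map_mul]
    congr 1
    refine MvPowerSeries.kernel_mul_eq_of_recurrence hs (fun k m => ?_) (fun k l m => ?_)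
    · simp only [coeff₃_gzGenFun]
      exact_mod_cast gzCount₃_zero_middle k m
    · simp only [coeff₃_gzGenFun]
      exact_mod_cast gzCount₃_succ_middle k l m
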